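/- **Definitions.** A *nilspace* is a set $X$ with sets of $n$-cubes $C^n(X)\subseteq X^{\{0,1\}^n}$ ($n\ge 0$) such that: (i) $c\circ\phi\in C^m(X)$ for all $c\in C^n(X)$ and all $\phi\colon\{0,1\}^m\to\{0,1\}^n$ that extend to affine maps $\mathbb R^m\to\mathbb R^n$; (ii) $C^0(X)=X$; (iii) for $n\ge1$, every $c'\colon\{0,1\}^n\setminus\{1^n\}\to X$ whose restrictions to the $(n-1)$-faces containing $0^n$ are in $C^{n-1}(X)$ extends to an element of $C^n(X)$. It is *$k$-step* if the extension in (iii) is unique for $n=k+1$, and *ergodic* if $C^1(X)=X^{\{0,1\}}$. A *nilspace morphism* is a map sending $n$-cubes to $n$-cubes for every $n\ge 0$. A *filtered abelian group* is an abelian group $G$ with subgroups $G=G_0\ge G_1\ge G_2\ge\cdots$. It is regarded as a nilspace whose $n$-cubes are the tuples $\bigl(\sum_{\alpha\in\{0,1\}^n}h_\alpha\prod_{i:\alpha_i=1}\omega_i\bigr)_{\omega\in\{0,1\}^n}$ with $h_\alpha\in G_{|\alpha|}$, where $|\alpha|=\alpha_1+\dots+\alpha_n$; it is $k$-step if $G_i=0$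 for all $i>k$. It is *compact* if $G$ is a compact Hausdorff topological abelian group. Write $\mathcal D^d(G)$ for $G$ with the filtration $G_i=G$ for $i\le d$ and $G_i=0$ for $i>d$. For a prime $p$, a nilspace $X$ is *$p$-homogeneous* if, for every $n\ge 0$ and every nilspace morphism $f\colon\mathcal D^1(\mathbb Z^n)\to X$, restricting $f$ to $\{0,\dots,p-1\}^n$ and extending periodically gives a nilspace morphism $\mathcal D^1(\mathbb F_p^n)\to X$. Let $X_2=\mathcal D^2(\mathbb F_2^2)$. Its $6$-cubes are the tuples $\bigl(x+\sum_i h_i\omega_i+\sum_{i<j}h_{ij}\omega_i\omega_j\bigr)_{\omega\in\{0,1\}^6}$ with $x,h_i,h_{ij}\in\mathbb F_2^2$. Define $\rho\colon C^6(X_2)\to\frac12\mathbb Z/\mathbb Z$ by sending such a $6$-cube to $$\tfrac12\sum h^{(1)}_{ab}h^{(1)}_{cd}h^{(2)}_{ef}\bmod 1,$$ where the superscripts denote the two coordinates in $\mathbb F_2^2$ and the sum is over the $45$ choices of $\{\{a,b\},\{c,d\}\},\{e,f\}$ for which the doubletons $\{a,b\},\{c,d\},\{e,f\}$ partition $\{1,\dots,6\}$.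 Let $X_{5,1}=X_2\times\frac12\mathbb Z/\mathbb Z$ as a set. Identifying $\{0,1\}^n$ with $\mathbb F_2^n$, its $n$-cubes are the pairs $(Q,S)$ with $Q\in C^n(X_2)$, $S\colon\mathbb F_2^n\to\frac12\mathbb Z/\mathbb Z$, and $$\sum_{\omega\in\{0,1\}^6}(-1)^{6-|\omega|}S(x+\omega\cdot\vec h)=\rho\bigl((Q(x+\omega\cdot\vec h))_{\omega\in\{0,1\}^6}\bigr)\qquad\text{for all }x,h_1,\dots,h_6\in\mathbb F_2^n,$$ where $\omega\cdot\vec h=\sum_i\omega_ih_i$. **Proposition.** $X_{5,1}$ is a finite ergodic $5$-step $2$-homogeneous nilspace, and there is no injective nilspace morphism from $X_{5,1}$ to any $5$-step compact filtered abelian group. (With the discrete topology $X_{5,1}$ is a compact nilspace, so this answers negatively, for $p=2$ and $k=5$, the question of Candela, González-Sánchez and Szegedy whether every $k$-step compact $p$-homogeneous nilspace has an injective nilspace morphism into a $k$-step compact filtered abelian group.) -/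

import Mathlib

/-- The vertices `{0,1}^n` of the discrete `n`-cube. -/
abbrev Vertex (n : ℕ) : Type := Fin n → Bool

/-- The vertex `1^n`. -/
def Vertex.top (n : ℕ) : Vertex n := fun _ => true

/-- The weight `|ω| = ω₁ + ⋯ + ωₙ`. -/
def Vertex.weight {n : ℕ} (ω : Vertex n) : ℕ :=
  (Finset.univ.filter fun i => ω i = true).card

/-- The inclusion `{0,1}^n ⊆ R^n`. -/
def Vertex.coords (R : Type*) [Zero R] [One R] {n : ℕ} (ω : Vertex n) : Fin n → R :=
  fun i => if ω i = true then 1 else 0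

/-- The identification of `𝔽₂^n` with `{0,1}^n` (inverse to `Vertex.coords (ZMod 2)`). -/
def Vertex.ofF2 {n : ℕ} (x : Fin n → ZMod 2) : Vertex n := fun i => decide (x i = 1)

/-- Cube morphisms: functions `{0,1}^m → {0,1}^n` that extend to an affine map `ℝ^m → ℝ^n`. -/
def IsCubeMorphism {m n : ℕ} (φ : Vertex m → Vertex n) : Prop :=
  ∃ g : (Fin m → ℝ) →ᵃ[ℝ] (Fin n → ℝ),
    ∀ ω : Vertex m, g (Vertex.coords ℝ ω) = Vertex.coords ℝ (φ ω)

/-- A collection of sets `C^n(X) ⊆ X^{{0,1}^n}`, one for each `n ≥ 0`. -/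
structure CubeStructure (X : Type*) where
  cubes : (n : ℕ) → Set (Vertex n → X)

namespace CubeStructure

variable {X Y : Type*}

/-- The values of `c` away from `1^(n+1)` form an `(n+1)`-corner: the restriction to every
`n`-face containing `0^(n+1)`, that is to every face `{ω : ω i = 0}`, is an `n`-cube.
(The value `c 1^(n+1)` plays no role.) -/
def IsCorner (C : CubeStructure X) (n : ℕ) (c : Vertex (n + 1) → X) : Prop :=
  ∀ i : Fin (n + 1),
    (fun ω : Vertex n => c (i.insertNth (α := fun _ => Bool) false ω)) ∈ C.cubes n

/-- The nilspace axioms: composition, `0`-ergodicity and corner completion. -/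
structure IsNilspace (C : CubeStructure X) : Prop where
  composition : ∀ (m n : ℕ) (φ : Vertex m → Vertex n), IsCubeMorphism φ →
    ∀ c ∈ C.cubes n, c ∘ φ ∈ C.cubes m
  zero_ergodic : C.cubes 0 = Set.univ
  completion : ∀ (n : ℕ) (c' : Vertex (n + 1) → X), C.IsCorner n c' →
    ∃ c ∈ C.cubes (n + 1), ∀ v, v ≠ Vertex.top (n + 1) → c v = c' v

/-- Ergodicity: `C^1(X) = X^{{0,1}}`. -/
def IsErgodic (C : CubeStructure X) : Prop := C.cubes 1 = Set.univ

/-- The `k`-step property: a completion of a `(k+1)`-corner is unique. -/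
def IsStep (C : CubeStructure X) (k : ℕ) : Prop :=
  ∀ c' : Vertex (k + 1) → X, C.IsCorner k c' →
    ∀ c₁ ∈ C.cubes (k + 1), ∀ c₂ ∈ C.cubes (k + 1),
      (∀ v, v ≠ Vertex.top (k + 1) → c₁ v = c' v) →
      (∀ v, v ≠ Vertex.top (k + 1) → c₂ v = c' v) → c₁ = c₂

/-- Nilspace morphisms: maps that preserve `n`-cubes for every `n ≥ 0`. -/
def IsMorphism (C : CubeStructure X) (D : CubeStructure Y) (f : X → Y) : Prop :=
  ∀ (n : ℕ), ∀ c ∈ C.cubes n, f ∘ c ∈ D.cubes n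

end CubeStructure

/-- A filtration `G = G₀ ≥ G₁ ≥ G₂ ≥ ⋯` of subgroups of an abelian group `G`. -/
structure AbFiltration (G : Type*) [AddCommGroup G] where
  level : ℕ → AddSubgroup G
  level_zero : level 0 = ⊤
  level_antitone : Antitone level

namespace AbFiltration

variable {G : Type*} [AddCommGroup G]

/-- The filtration has degree at most `d`: `G_i = 0` for `i > d`. Equivalently, the filtered
abelian group is `d`-step. -/
def DegreeLE (F : AbFiltration G) (d : ℕ) : Prop := ∀ i, d < i → F.level i = ⊥

/-- The nilspace structure of a filtered abelian group, given by the Host--Kra groups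
`C^n(G) = G^{[n]}`: its `n`-cubes are the tuples
`(∑_α h_α ∏_{i : α_i = 1} ω_i)_ω` with `h_α ∈ G_{|α|}`. -/
def cubeStructure (F : AbFiltration G) : CubeStructure G where
  cubes n := {c | ∃ h : Vertex n → G, (∀ α, h α ∈ F.level α.weight) ∧
    ∀ ω : Vertex n,
      c ω = ∑ α ∈ Finset.univ.filter (fun α : Vertex n => ∀ i, α i = true → ω i = true), h α}

/-- The degree `d` filtration: `G_i = G` for `i ≤ d` and `G_i = 0` for `i > d`. -/
def ofDegree (G : Type*) [AddCommGroup G] (d : ℕ) : AbFiltration G where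
  level i := if i ≤ d then ⊤ else ⊥
  level_zero := by simp
  level_antitone := by
    intro i j hij
    by_cases hj : j ≤ d
    · simp [hj, hij.trans hj]
    · simp [hj]

end AbFiltration

/-- `𝒟^d(G)`: the abelian group `G` with the degree `d` filtration, as a nilspace. -/
def degreeCubes (d : ℕ) (G : Type*) [AddCommGroup G] : CubeStructure G :=
  (AbFiltration.ofDegree G d).cubeStructure

/-- `p`-homogeneity: for each morphism `f : 𝒟^1(ℤ^n) → X`, the restriction of `f` to
`{0,…,p-1}^n`, extended periodically, is a morphism `𝒟^1(𝔽_p^n) → X`. -/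
def CubeStructure.IsHomogeneous {X : Type*} (C : CubeStructure X) (p : ℕ) : Prop :=
  ∀ (n : ℕ) (f : (Fin n → ℤ) → X), (degreeCubes 1 (Fin n → ℤ)).IsMorphism C f →
    (degreeCubes 1 (Fin n → ZMod p)).IsMorphism C
      (fun x : Fin n → ZMod p => f fun i => ((x i).val : ℤ))

/-- The alternating sum `∑_{ω ∈ {0,1}^k} (-1)^{k-|ω|} F_ω` of a tuple in an abelian group. -/
def alternatingSum {Z : Type*} [AddCommGroup Z] {k : ℕ} (F : Vertex k → Z) : Z :=
  ∑ ω : Vertex k, ((-1 : ℤ) ^ (k - ω.weight)) • F ω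

/-- The parallelepiped `(x + ω · h)_{ω ∈ {0,1}^k}` in `𝔽₂^n`, with `𝔽₂^n` identified with
`{0,1}^n`. -/
def boxMap {n k : ℕ} (x : Fin n → ZMod 2) (h : Fin k → Fin n → ZMod 2) :
    Vertex k → Vertex n :=
  fun ω => Vertex.ofF2 (x + ∑ i, Vertex.coords (ZMod 2) ω i • h i)

/-- The underlying set `𝔽₂²` of `X₂ = 𝒟²(𝔽₂²)`; the coordinates `q⁽¹⁾, q⁽²⁾` are
`q 0, q 1`. -/
abbrev X2 : Type := Fin 2 → ZMod 2

/-- The nilspace structure of `X₂ = 𝒟²(𝔽₂²)`. -/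
def X2.cubeStructure : CubeStructure X2 := degreeCubes 2 X2

/-- For a `6`-cube `c_ω = x + ∑_i h_i ω_i + ∑_{i<j} h_{ij} ω_i ω_j` of `X₂`, the coefficient
`h_{ij}` (`i ≠ j`), that is `c(e_i + e_j) - c(e_i) - c(e_j) + c(0)`. -/
def X2.coeff (c : Vertex 6 → X2) (i j : Fin 6) : X2 :=
  c (fun l => decide (l = i ∨ l = j)) - c (fun l => decide (l = i))
    - c (fun l => decide (l = j)) + c (fun _ => false)

/-- The permutations `(a,b,c,d,e,f)` of the six indices with `a < b`, `c < d`, `e < f` and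
`a < c`. They represent, once each, the `45` ways to partition the indices into doubletons
`{a,b}, {c,d}, {e,f}`, the first two of which are unordered. -/
def doubletonPartitions : Finset (Equiv.Perm (Fin 6)) :=
  Finset.univ.filter fun σ => σ 0 < σ 1 ∧ σ 2 < σ 3 ∧ σ 4 < σ 5 ∧ σ 0 < σ 2

/-- The `5`-cocycle `ρ : C⁶(X₂) → ½ℤ/ℤ`, sending a `6`-cube of `X₂` to
`½ ∑ h⁽¹⁾_{ab} h⁽¹⁾_{cd} h⁽²⁾_{ef}` over the partitions above. Here and below `½ℤ/ℤ` is
identified with `ZMod 2` through `a ↦ a/2`. The formula is only ever applied to `6`-cubes. -/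
def rho (c : Vertex 6 → X2) : ZMod 2 :=
  ∑ σ ∈ doubletonPartitions,
    X2.coeff c (σ 0) (σ 1) 0 * X2.coeff c (σ 2) (σ 3) 0 * X2.coeff c (σ 4) (σ 5) 1

/-- The underlying set `X₂ × ½ℤ/ℤ` of `X_{5,1}`. -/
abbrev X51 : Type := X2 × ZMod 2

/-- The cubes of `X_{5,1}`: the pairs `(Q, S)` with `Q ∈ C^n(X₂)` and `d⁶ S = Q^* ρ` on
`C⁶(𝒟^1(𝔽₂^n))`, that is on all parallelepipeds `(x + ω · h)_{ω ∈ {0,1}^6}` of `𝔽₂^n`. -/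
def X51.cubeStructure : CubeStructure X51 where
  cubes n := {c | (fun ω => (c ω).1) ∈ X2.cubeStructure.cubes n ∧
    ∀ (x : Fin n → ZMod 2) (h : Fin 6 → Fin n → ZMod 2),
      alternatingSum (fun ω => (c (boxMap x h ω)).2) =
        rho (fun ω => (c (boxMap x h ω)).1)}

/-! Over `𝔽₂` signs disappear, so `d⁶S` becomes the plain sum `boxSum` of `S` over a parallelepiped.
For a cube `Q` of `X₂`, second differences of its coordinates give alternating bilinear forms `B₁,
B₂`, and `ρ` on a parallelepiped is a polarized Pfaffian: the coefficient of `s²t` in `Pf(s B₁ + t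
B₂)`, evaluated at the six directions. It is an alternating 6-form, independent of the base point
(`rho_boxMap`). An identity "box sum = alternating form" need only be tested on distinct basis
directions (`boxSum_eq_of_basis`) and propagates from the faces of a corner (`boxSum_eq_of_faces`);
this gives the nilspace axioms. Invariance of the cubes under all `𝔽₂`-affine maps gives
2-homogeneity.

For non-embeddability, let `f` be a morphism to a 5-step filtered group. Alternating sums of `f`
over 6-cubes vanish, which forces `f(x, s+1) - f(x, s)` to be one constant `D`
(`X51.vertical_difference_eq`). The cube `pencilCube` has `s B₁ + t B₂` with Pfaffian `st(s+t)`: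
this is zero at every point of `𝔽₂²`, yet its `s²t` coefficient is 1. Vanishing at points makes the
alternating sum of every function of `Q` zero; the nonzero coefficient permits a lift whose second
coordinate is 1 at the top vertex only. Applying `f` to the lift leaves `D = 0`, so `f` is not
injective. -/

/-! ### Sums over parallelepipeds in characteristic 2. -/

section BoxSum

variable {n k : ℕ} {Z : Type*} [AddCommGroup Z]

/-- The sum of `F` over the parallelepiped `(x + ω · h)_ω`. -/
def boxSum (F : (Fin n → ZMod 2) → Z) (x : Fin n → ZMod 2) (h : Fin k → Fin n → ZMod 2) : Z :=
  ∑ ω : Vertex k, F (x + ∑ i, Vertex.coords (ZMod 2) ω i • h i)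

/-- The basis directions `e_{I 0}, …, e_{I (k-1)}`. -/
def basisDirs (I : Fin k → Fin n) : Fin k → Fin n → ZMod 2 := fun l => Pi.single (I l) 1

theorem alternatingSum_eq_sum [Module (ZMod 2) Z] (F : Vertex k → Z) :
    alternatingSum F = ∑ ω, F ω := by
  refine Finset.sum_congr rfl fun ω _ => ?_
  rcases neg_one_pow_eq_or ℤ (k - ω.weight) with h | h <;> simp [h, ZModModule.neg_eq_self]

theorem alternatingSum_boxMap [Module (ZMod 2) Z] (c : Vertex n → Z) (x : Fin n → ZMod 2)
    (h : Fin k → Fin n → ZMod 2) :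
    alternatingSum (fun ω => c (boxMap x h ω)) = boxSum (fun v => c (Vertex.ofF2 v)) x h :=
  alternatingSum_eq_sum _

theorem boxSum_split (F : (Fin n → ZMod 2) → Z) (x : Fin n → ZMod 2)
    (h : Fin (k + 1) → Fin n → ZMod 2) (i : Fin (k + 1)) :
    boxSum F x h = boxSum F x (fun j => h (i.succAbove j)) +
      boxSum F (x + h i) (fun j => h (i.succAbove j)) := by
  unfold boxSum
  rw [← (Fin.insertNthEquiv (fun _ => Bool) i).sum_comp, Fintype.sum_prod_type,
    Fintype.sum_bool, add_comm]
  congr 1 <;> refine Finset.sum_congr rfl fun ω _ => ?_ <;>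
    simp [Fin.sum_univ_succAbove _ i, Vertex.coords, add_assoc]

theorem boxSum_zero (F : (Fin n → ZMod 2) → Z) (x : Fin n → ZMod 2)
    (h : Fin 0 → Fin n → ZMod 2) : boxSum F x h = F x := by
  simp [boxSum]

theorem boxSum_one (F : (Fin n → ZMod 2) → Z) (x : Fin n → ZMod 2)
    (h : Fin 1 → Fin n → ZMod 2) : boxSum F x h = F x + F (x + h 0) := by
  rw [boxSum_split F x h 0, boxSum_zero, boxSum_zero]

theorem boxSum_two (F : (Fin n → ZMod 2) → Z) (x a b : Fin n → ZMod 2) :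
    boxSum F x ![a, b] = F x + F (x + b) + (F (x + a) + F (x + a + b)) := by
  rw [boxSum_split F x _ 0, boxSum_one, boxSum_one]
  simp

theorem boxSum_add_dir (F : (Fin n → ZMod 2) → Z) (x : Fin n → ZMod 2)
    (h : Fin k → Fin n → ZMod 2) (i : Fin k) : boxSum F (x + h i) h = boxSum F x h := by
  cases k with
  | zero => exact i.elim0
  | succ k =>
    rw [boxSum_split F _ h i, boxSum_split F x h i, add_assoc, ZModModule.add_self, add_zero,
      add_comm]

theorem boxSum_basis_univ (F : (Fin n → ZMod 2) → Z) (x : Fin n → ZMod 2)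
    (I : Fin n → Fin n) (hI : Function.Injective I) :
    boxSum F x (basisDirs I) = ∑ v, F v := by
  have hb : Function.Bijective
      fun ω : Vertex n => x + ∑ i, Vertex.coords (ZMod 2) ω i • basisDirs I i := by
    rw [Fintype.bijective_iff_injective_and_card]
    refine ⟨fun ω ω' e => ?_, by simp [ZMod.card]⟩
    funext i
    have e1 := congrFun (add_left_cancel e) (I i)
    simp only [Finset.sum_apply, Pi.smul_apply, basisDirs, Pi.single_apply, hI.eq_iff,
      smul_eq_mul, mul_ite, mul_one, mul_zero, Finset.sum_ite_eq, Finset.mem_univ, if_true,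
      Vertex.coords] at e1
    revert e1
    cases ω i <;> cases ω' i <;> decide
  exact hb.sum_comp F

variable [Module (ZMod 2) Z]

theorem boxSum_eq_zero_of_invariant (F : (Fin n → ZMod 2) → Z) (x : Fin n → ZMod 2)
    (h : Fin k → Fin n → ZMod 2) (i : Fin k) (H : ∀ v, F (v + h i) = F v) :
    boxSum F x h = 0 := by
  cases k with
  | zero => exact i.elim0
  | succ k =>
    rw [boxSum_split F x h i]
    have : boxSum F (x + h i) (fun j => h (i.succAbove j)) =
        boxSum F x (fun j => h (i.succAbove j)) := by
      refine Finset.sum_congr rfl fun ω _ => ?_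
      rw [add_right_comm, H]
    rw [this, ZModModule.add_self]

theorem boxSum_eq_zero_of_eq (F : (Fin n → ZMod 2) → Z) (x : Fin n → ZMod 2)
    (h : Fin k → Fin n → ZMod 2) (i j : Fin k) (hij : i ≠ j) (e : h i = h j) :
    boxSum F x h = 0 := by
  cases k with
  | zero => exact i.elim0
  | succ k =>
    obtain ⟨j', rfl⟩ := Fin.exists_succAbove_eq hij.symm
    rw [boxSum_split F x h i, e, boxSum_add_dir F x (fun j => h (i.succAbove j)) j',
      ZModModule.add_self]

/-- Telescoping: the two middle terms agree and cancel. The shift of base point to `x + a` is the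
only obstruction to additivity in each direction. -/
theorem boxSum_update_add (F : (Fin n → ZMod 2) → Z) (x : Fin n → ZMod 2)
    (h : Fin k → Fin n → ZMod 2) (i : Fin k) (a b : Fin n → ZMod 2) :
    boxSum F x (Function.update h i (a + b)) =
      boxSum F x (Function.update h i a) + boxSum F (x + a) (Function.update h i b) := by
  cases k with
  | zero => exact i.elim0
  | succ k =>
    have key : ∀ (y c : Fin n → ZMod 2), boxSum F y (Function.update h i c) =
        boxSum F y (fun j => h (i.succAbove j)) +
          boxSum F (y + c) (fun j => h (i.succAbove j)) := by
      intro y c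
      rw [boxSum_split F y _ i]
      simp [Fin.succAbove_ne]
    have aux : ∀ u v w : Z, u + w = u + v + (v + w) := fun u v w => by
      rw [add_assoc, ← add_assoc v v, ZModModule.add_self, zero_add]
    rw [key, key, key, add_assoc x a b]
    exact aux _ _ _

/-- A box-sum identity with an alternating form may be checked on distinct basis directions. -/
theorem boxSum_eq_of_basis (F : (Fin n → ZMod 2) → Z)
    (T : (Fin n → ZMod 2) [⋀^Fin k]→ₗ[ZMod 2] Z)
    (H : ∀ x (I : Fin k → Fin n), Function.Injective I →
      boxSum F x (basisDirs I) = T (basisDirs I))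
    (x : Fin n → ZMod 2) (h : Fin k → Fin n → ZMod 2) : boxSum F x h = T h := by
  have H1 : ∀ x (I : Fin k → Fin n), boxSum F x (basisDirs I) = T (basisDirs I) := by
    intro x I
    by_cases hI : Function.Injective I
    · exact H x I hI
    · simp only [Function.Injective, not_forall] at hI
      obtain ⟨i, j, e, hij⟩ := hI
      have e' : basisDirs I i = basisDirs I j := by simp [basisDirs, e]
      rw [boxSum_eq_zero_of_eq F x _ i j hij e', T.map_eq_zero_of_eq _ e' hij]
  have H2 : ∀ (s : Finset (Fin k)) (h : Fin k → Fin n → ZMod 2),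
      (∀ i, i ∉ s → ∃ l, h i = Pi.single l 1) → ∀ x, boxSum F x h = T h := by
    intro s
    induction s using Finset.induction_on with
    | empty =>
      intro h hh x
      choose I hI using fun i => hh i (Finset.notMem_empty i)
      have : h = basisDirs I := funext hI
      rw [this, H1]
    | insert i s hi ih =>
      intro h hh
      -- Quantifying over all base points inside `A` absorbs the shift in `boxSum_update_add`; `A`
      -- then contains the basis vectors, hence everything.
      let A : AddSubmonoid (Fin n → ZMod 2) :=
        { carrier := {a | ∀ x, boxSum F x (Function.update h i a) = T (Function.update h i a)}
          zero_mem' := by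
            intro x
            rw [boxSum_eq_zero_of_invariant F x _ i (by simp), T.map_update_zero]
          add_mem' := by
            intro a b ha hb x
            rw [boxSum_update_add, ha, hb, T.map_update_add] }
      have hA : ∀ l, Pi.single l 1 ∈ A := by
        intro l x
        refine ih _ (fun j hj => ?_) x
        by_cases hji : j = i
        · subst hji
          exact ⟨l, by simp⟩
        · obtain ⟨m, hm⟩ := hh j (by simp [hji, hj])
          exact ⟨m, by simpa [hji] using hm⟩
      have : h i ∈ A := by
        rw [← Finset.univ_sum_single (h i)]
        refine A.sum_mem fun l _ => ?_
        have h2 : ∀ z : ZMod 2, z = 0 ∨ z = 1 := by decide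
        rcases h2 (h i l) with e | e
        · rw [e, Pi.single_zero]; exact A.zero_mem
        · rw [e]; exact hA l
      intro x
      simpa using this x
  exact H2 Finset.univ h (by simp) x

theorem AlternatingMap.basisDirs_perm (T : (Fin n → ZMod 2) [⋀^Fin n]→ₗ[ZMod 2] Z)
    (I : Fin n → Fin n) (hI : Function.Injective I) : T (basisDirs I) = T (basisDirs id) := by
  have := T.map_perm (basisDirs id) (Equiv.ofBijective I (Finite.injective_iff_bijective.1 hI))
  have e : basisDirs id ∘ (Equiv.ofBijective I (Finite.injective_iff_bijective.1 hI)) =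
    basisDirs I := rfl
  rw [e] at this
  rw [this]
  rcases Int.units_eq_one_or (Equiv.Perm.sign
    (Equiv.ofBijective I (Finite.injective_iff_bijective.1 hI))) with h | h <;>
    simp [h, ZModModule.neg_eq_self]

/-- If a box-sum identity holds in all faces through `0` and the total sum is right, it holds
everywhere. -/
theorem boxSum_basis_of_faces (F : (Fin n → ZMod 2) → Z) (d : ℕ) : ∀ (k : ℕ), n = k + d →
    ∀ (T : (Fin n → ZMod 2) [⋀^Fin k]→ₗ[ZMod 2] Z),
    (∀ (j : Fin n) (x : Fin n → ZMod 2) (h : Fin k → Fin n → ZMod 2), x j = 0 →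
      (∀ l, h l j = 0) → boxSum F x h = T h) →
    (∀ I : Fin k → Fin n, d = 0 → Function.Injective I → ∑ v, F v = T (basisDirs I)) →
    (d ≠ 0 → ∑ v, F v = 0) →
    ∀ x (I : Fin k → Fin n), Function.Injective I →
      boxSum F x (basisDirs I) = T (basisDirs I) := by
  induction d with
  | zero =>
    intro k hk T _ h0 _ x I hI
    obtain rfl : n = k := by simpa using hk
    rw [boxSum_basis_univ F x I hI, h0 I rfl hI]
  | succ d ih =>
    intro k hk T hT _ h0 x I hI
    have hs : ∑ v, F v = 0 := h0 (by simp)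
    -- On faces a (k+1)-fold sum is `T + T = 0`, so the induction hypothesis makes all (k+1)-fold
    -- sums along distinct basis directions vanish.
    have hvan := ih (k + 1) (by omega) 0 (fun j x h hx hh => by
      rw [boxSum_split F x h 0, hT j x _ hx (fun l => hh _),
        hT j (x + h 0) _ (by simp [hx, hh]) (fun l => hh _), ZModModule.add_self]
      rfl) (fun _ _ _ => by rw [hs]; rfl) (fun _ => hs)
    -- As `k < n`, some basis direction `j` is unused. Vanishing of the sum along `j` and `I`
    -- carries the identity from the face `x j = 0` to `x j = 1`.
    obtain ⟨j, hj⟩ : ∃ j, j ∉ Set.range I := by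
      by_contra hcon
      push Not at hcon
      have := Fintype.card_le_of_surjective I hcon
      simp at this
      omega
    have hj' : ∀ l, I l ≠ j := fun l e => hj ⟨l, e⟩
    have hface : ∀ y : Fin n → ZMod 2, y j = 0 →
        boxSum F y (basisDirs I) = T (basisDirs I) := fun y hy =>
      hT j y _ hy fun l => by simp [basisDirs, (hj' l).symm]
    have h2 : ∀ z : ZMod 2, z = 0 ∨ z = 1 := by decide
    rcases h2 (x j) with hx | hx
    · exact hface x hx
    · have hc : Function.Injective (Fin.cons j I : Fin (k + 1) → Fin n) :=
        Fin.cons_injective_iff.2 ⟨hj, hI⟩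
      have := hvan x _ hc
      rw [boxSum_split F x _ 0] at this
      have e1 : (fun l : Fin k => basisDirs (Fin.cons j I : Fin (k + 1) → Fin n)
          ((0 : Fin (k + 1)).succAbove l)) = basisDirs I := by
        funext l; simp [basisDirs]
      rw [e1, hface (x + basisDirs (Fin.cons j I : Fin (k + 1) → Fin n) 0)
        (by simp [basisDirs, hx]; decide)] at this
      have h3 : boxSum F x (basisDirs I) + T (basisDirs I) = 0 := this
      rw [← sub_eq_zero, ZModModule.sub_eq_add, h3]

/-- Completion of corners for box-sum identities. -/
theorem boxSum_eq_of_faces (F : (Fin n → ZMod 2) → Z)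
    (T : (Fin n → ZMod 2) [⋀^Fin k]→ₗ[ZMod 2] Z)
    (hT : ∀ (j : Fin n) (x : Fin n → ZMod 2) (h : Fin k → Fin n → ZMod 2), x j = 0 →
      (∀ l, h l j = 0) → boxSum F x h = T h)
    (h0 : ∀ e : n = k, ∑ v, F v = T (basisDirs (Fin.cast e.symm)))
    (h1 : k < n → ∑ v, F v = 0)
    (x : Fin n → ZMod 2) (h : Fin k → Fin n → ZMod 2) : boxSum F x h = T h := by
  refine boxSum_eq_of_basis F T (fun x I hI => ?_) x h
  have hkn : k ≤ n := by simpa using Fintype.card_le_of_injective I hI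
  obtain ⟨d, rfl⟩ := Nat.exists_eq_add_of_le hkn
  refine boxSum_basis_of_faces F d k rfl T hT (fun I hd hI => ?_) (fun hd => h1 (by omega)) x I hI
  subst hd
  rw [h0 rfl]
  exact (T.basisDirs_perm I hI).symm

end BoxSum

/-! ### Cubes of filtered groups and their top coefficient. -/

section CubeSum

variable {n : ℕ} {G : Type*} [AddCommGroup G]

/-- The tuple `(∑_α h_α ∏_{i : α_i = 1} ω_i)_ω`. -/
def cubeSum (h : Vertex n → G) (ω : Vertex n) : G :=
  ∑ α ∈ Finset.univ.filter (fun α : Vertex n => ∀ i, α i = true → ω i = true), h α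

theorem Vertex.sum_succ (f : Vertex (n + 1) → G) :
    ∑ α, f α = ∑ α : Vertex n, f (Fin.cons (α := fun _ => Bool) true α) +
      ∑ α : Vertex n, f (Fin.cons (α := fun _ => Bool) false α) := by
  rw [← (Fin.consEquiv (fun _ => Bool)).sum_comp, Fintype.sum_prod_type, Fintype.sum_bool]
  rfl

theorem Vertex.weight_cons (b : Bool) (ω : Vertex n) :
    Vertex.weight (Fin.cons (α := fun _ => Bool) b ω : Vertex (n + 1)) =
      (if b = true then 1 else 0) + ω.weight := by
  unfold Vertex.weight
  rw [Finset.card_filter, Finset.card_filter, Fin.sum_univ_succ]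
  simp

theorem Vertex.weight_le (ω : Vertex n) : ω.weight ≤ n :=
  (Finset.card_le_univ _).trans (by simp)

theorem cubeSum_cons_false (h : Vertex (n + 1) → G) (ω : Vertex n) :
    cubeSum h (Fin.cons (α := fun _ => Bool) false ω) =
      cubeSum (fun α => h (Fin.cons (α := fun _ => Bool) false α)) ω := by
  unfold cubeSum
  rw [Finset.sum_filter, Finset.sum_filter, Vertex.sum_succ]
  simp [Fin.forall_fin_succ]

theorem cubeSum_cons_true (h : Vertex (n + 1) → G) (ω : Vertex n) :
    cubeSum h (Fin.cons (α := fun _ => Bool) true ω) =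
      cubeSum (fun α => h (Fin.cons (α := fun _ => Bool) true α)) ω +
        cubeSum (fun α => h (Fin.cons (α := fun _ => Bool) false α)) ω := by
  unfold cubeSum
  rw [Finset.sum_filter, Finset.sum_filter, Finset.sum_filter, Vertex.sum_succ]
  simp [Fin.forall_fin_succ]

/-- Möbius inversion, one coordinate at a time: differencing in the first coordinate leaves the
coefficients `h_α` with `α 0 = true`. -/
theorem alternatingSum_cubeSum {k : ℕ} (h : Vertex k → G) :
    alternatingSum (cubeSum h) = h (Vertex.top k) := by
  induction k with
  | zero => simp [alternatingSum, cubeSum, Subsingleton.elim _ (Vertex.top 0)]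
  | succ k ih =>
    have e : Vertex.top (k + 1) = Fin.cons (α := fun _ => Bool) true (Vertex.top k) := by
      funext i; refine Fin.cases rfl (fun _ => rfl) i
    rw [e, ← ih fun α => h (Fin.cons (α := fun _ => Bool) true α)]
    unfold alternatingSum
    rw [Vertex.sum_succ, ← Finset.sum_add_distrib]
    refine Finset.sum_congr rfl fun ω _ => ?_
    have hw : k + 1 - ω.weight = k - ω.weight + 1 := by
      have := ω.weight_le; omega
    have hw' : k + 1 - (1 + ω.weight) = k - ω.weight := by omega
    simp [Vertex.weight_cons, hw, hw', cubeSum_cons_true, cubeSum_cons_false, pow_succ]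

theorem alternatingSum_eq_zero_of_mem_cubes {F : AbFiltration G} {d : ℕ} (hF : F.DegreeLE d)
    {c : Vertex (d + 1) → G} (hc : c ∈ F.cubeStructure.cubes (d + 1)) :
    alternatingSum c = 0 := by
  obtain ⟨h, hh, hc⟩ := hc
  have e : c = cubeSum h := funext hc
  have := hh (Vertex.top (d + 1))
  rw [hF _ (by simp [Vertex.weight, Vertex.top])] at this
  rw [e, alternatingSum_cubeSum]
  simpa using this

theorem mem_degreeCubes_iff {d : ℕ} {c : Vertex n → G} :
    c ∈ (degreeCubes d G).cubes n ↔
      ∃ h : Vertex n → G, (∀ α, d < α.weight → h α = 0) ∧ ∀ ω, c ω = cubeSum h ω := by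
  have key : ∀ (g : G) (i : ℕ), g ∈ (AbFiltration.ofDegree G d).level i ↔ (d < i → g = 0) := by
    intro g i
    by_cases hi : i ≤ d
    · simp [AbFiltration.ofDegree, hi]
    · simp [AbFiltration.ofDegree, hi, not_le.1 hi]
  constructor
  · rintro ⟨h, h1, h2⟩
    exact ⟨h, fun α => (key _ _).1 (h1 α), h2⟩
  · rintro ⟨h, h1, h2⟩
    exact ⟨h, fun α => (key _ _).2 (h1 α), h2⟩

end CubeSum

/-! ### Polynomials over `𝔽₂` characterized by vanishing derivatives. -/

section Degree

theorem boxSum_cons {Z : Type*} [AddCommGroup Z] {n k : ℕ} (F : (Fin (n + 1) → ZMod 2) → Z) (b : ZMod 2)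
    (x : Fin n → ZMod 2) (h : Fin k → Fin n → ZMod 2) :
    boxSum F (Fin.cons (α := fun _ => ZMod 2) b x)
        (fun l => Fin.cons (α := fun _ => ZMod 2) 0 (h l)) =
      boxSum (fun y => F (Fin.cons (α := fun _ => ZMod 2) b y)) x h := by
  refine Finset.sum_congr rfl fun ω _ => congrArg F ?_
  funext i
  refine Fin.cases (by simp) (fun j => by simp) i

variable {Z : Type*} [AddCommGroup Z] [Module (ZMod 2) Z]

/-- A monomial in fewer than `d` variables omits one of any `d` distinct basis directions, so it is
invariant along it and its box sum vanishes. -/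
theorem boxSum_cubeSum {n d : ℕ} (h : Vertex n → Z) (hh : ∀ α, d ≤ α.weight → h α = 0)
    (x : Fin n → ZMod 2) (v : Fin d → Fin n → ZMod 2) :
    boxSum (fun y => cubeSum h (Vertex.ofF2 y)) x v = 0 := by
  refine boxSum_eq_of_basis _ 0 (fun x I hI => ?_) x v
  have e : boxSum (fun y => cubeSum h (Vertex.ofF2 y)) x (basisDirs I) =
      ∑ α, boxSum (fun y => if ∀ i, α i = true → Vertex.ofF2 y i = true then h α else 0) x
        (basisDirs I) := by
    unfold boxSum cubeSum
    rw [Finset.sum_comm]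
    simp only [Finset.sum_filter]
  rw [e]
  refine Finset.sum_eq_zero fun α _ => ?_
  by_cases hα : d ≤ α.weight
  · simp [hh α hα, boxSum]
  · obtain ⟨l, hl⟩ : ∃ l, α (I l) = false := by
      by_contra hcon
      push Not at hcon
      apply hα
      have := Finset.card_le_card (s := Finset.univ.image I)
        (t := Finset.univ.filter fun i => α i = true) (by
          intro i hi
          obtain ⟨l, _, rfl⟩ := Finset.mem_image.1 hi
          simpa using hcon l)
      rwa [Finset.card_image_of_injective _ hI, Finset.card_univ, Fintype.card_fin] at this
    refine boxSum_eq_zero_of_invariant _ _ _ l fun y => ?_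
    have : (∀ i, α i = true → Vertex.ofF2 (y + basisDirs I l) i = true) ↔
        ∀ i, α i = true → Vertex.ofF2 y i = true := by
      refine forall_congr' fun i => imp_congr_right fun hi => ?_
      have : i ≠ I l := by rintro rfl; simp [hl] at hi
      simp [Vertex.ofF2, basisDirs, this]
    simp only [this]

theorem Vertex.ofF2_cons_zero {n : ℕ} (x : Fin n → ZMod 2) :
    Vertex.ofF2 (Fin.cons (α := fun _ => ZMod 2) 0 x) =
      Fin.cons (α := fun _ => Bool) false (Vertex.ofF2 x) := by
  funext i; refine Fin.cases (by simp [Vertex.ofF2]) (fun j => by simp [Vertex.ofF2]) i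

theorem Vertex.ofF2_cons_one {n : ℕ} (x : Fin n → ZMod 2) :
    Vertex.ofF2 (Fin.cons (α := fun _ => ZMod 2) 1 x) =
      Fin.cons (α := fun _ => Bool) true (Vertex.ofF2 x) := by
  funext i; refine Fin.cases (by simp [Vertex.ofF2]) (fun j => by simp [Vertex.ofF2]) i

/-- Taylor expansion in the first variable: the restriction to `0` keeps the degree bound, and the
derivative in that variable has degree one less. -/
theorem exists_cubeSum_of_boxSum {n : ℕ} : ∀ (d : ℕ) (c : Vertex n → Z),
    (∀ x (v : Fin d → Fin n → ZMod 2), boxSum (fun y => c (Vertex.ofF2 y)) x v = 0) →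
    ∃ h : Vertex n → Z, (∀ α, d ≤ α.weight → h α = 0) ∧ ∀ ω, c ω = cubeSum h ω := by
  have triv : ∀ (m : ℕ) (c : Vertex m → Z),
      (∀ x (v : Fin 0 → Fin m → ZMod 2), boxSum (fun y => c (Vertex.ofF2 y)) x v = 0) →
      ∀ ω, c ω = 0 := by
    intro m c H ω
    have := H (Vertex.coords (ZMod 2) ω) Fin.elim0
    rw [boxSum_zero] at this
    have e : Vertex.ofF2 (Vertex.coords (ZMod 2) ω) = ω := by
      funext i; cases hi : ω i <;> simp [Vertex.ofF2, Vertex.coords, hi]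
    rwa [e] at this
  induction n with
  | zero =>
    intro d c H
    refine ⟨c, fun α hα => ?_, fun ω => by
      simpa [cubeSum] using congrArg c (Subsingleton.elim _ _)⟩
    have := α.weight_le
    obtain rfl : d = 0 := by omega
    exact triv 0 c H α
  | succ n ih =>
    intro d c H
    cases d with
    | zero => exact ⟨0, fun _ _ => rfl, fun ω => by rw [triv _ c H]; simp [cubeSum]⟩
    | succ d =>
      obtain ⟨h0, h0w, h0c⟩ := ih (d + 1) (fun ω => c (Fin.cons (α := fun _ => Bool) false ω))
        (fun x v => by
          rw [← H (Fin.cons (α := fun _ => ZMod 2) 0 x)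
            (fun l => Fin.cons (α := fun _ => ZMod 2) 0 (v l)), boxSum_cons]
          simp only [Vertex.ofF2_cons_zero])
      obtain ⟨h1, h1w, h1c⟩ := ih d (fun ω => c (Fin.cons (α := fun _ => Bool) false ω) +
          c (Fin.cons (α := fun _ => Bool) true ω))
        (fun x v => by
          rw [← H (Fin.cons (α := fun _ => ZMod 2) 0 x)
            (Fin.cons (α := fun _ => Fin (n + 1) → ZMod 2) (Fin.cons (α := fun _ => ZMod 2) 1 0)
              (fun l => Fin.cons (α := fun _ => ZMod 2) 0 (v l))), boxSum_split _ _ _ 0]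
          have e : Fin.cons (α := fun _ => ZMod 2) 0 x +
              Fin.cons (α := fun _ => ZMod 2) 1 0 = Fin.cons (α := fun _ => ZMod 2) 1 x := by
            funext i; refine Fin.cases (by simp) (fun j => by simp) i
          simp only [Fin.cons_zero, Fin.succAbove_zero, Fin.cons_succ, e]
          rw [boxSum_cons, boxSum_cons]
          simp only [Vertex.ofF2_cons_zero, Vertex.ofF2_cons_one]
          exact Finset.sum_add_distrib)
      refine ⟨fun α => if α 0 = true then h1 (Fin.tail α) else h0 (Fin.tail α), fun α hα => ?_,
        fun ω => ?_⟩
      · obtain ⟨b, α, rfl⟩ : ∃ b α', α = Fin.cons (α := fun _ => Bool) b α' :=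
          ⟨α 0, Fin.tail α, (Fin.cons_self_tail α).symm⟩
        rw [Vertex.weight_cons] at hα
        cases b
        · simpa using h0w α (by simpa using hα)
        · simpa using h1w α (by simp at hα; omega)
      · obtain ⟨b, ω, rfl⟩ : ∃ b ω', ω = Fin.cons (α := fun _ => Bool) b ω' :=
          ⟨ω 0, Fin.tail ω, (Fin.cons_self_tail ω).symm⟩
        cases b
        · rw [cubeSum_cons_false]
          simpa using h0c ω
        · rw [cubeSum_cons_true]
          simp only [Fin.cons_zero, if_true, Fin.tail_cons, Bool.false_eq_true, if_false]
          rw [← h1c, ← h0c, add_right_comm, ZModModule.add_self, zero_add]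

/-- Degree `≤ d` polynomials on `𝔽₂^n` are the functions killed by `d + 1` derivatives. -/
theorem mem_degreeCubes_iff_boxSum {n d : ℕ} {c : Vertex n → Z} :
    c ∈ (degreeCubes d Z).cubes n ↔
      ∀ x (v : Fin (d + 1) → Fin n → ZMod 2), boxSum (fun y => c (Vertex.ofF2 y)) x v = 0 := by
  rw [mem_degreeCubes_iff]
  constructor
  · rintro ⟨h, hh, hc⟩ x v
    simp only [hc]
    exact boxSum_cubeSum h hh x v
  · exact exists_cubeSum_of_boxSum (d + 1) c

end Degree

/-! ### The polarized Pfaffian as an alternating form. -/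

/-- The representative in `doubletonPartitions` of the partition given by a permutation. -/
def sortDoubletons (τ : Equiv.Perm (Fin 6)) : Equiv.Perm (Fin 6) :=
  let τ := if τ 0 < τ 1 then τ else τ * Equiv.swap 0 1
  let τ := if τ 2 < τ 3 then τ else τ * Equiv.swap 2 3
  let τ := if τ 4 < τ 5 then τ else τ * Equiv.swap 4 5
  if τ 0 < τ 2 then τ else τ * (Equiv.swap 0 2 * Equiv.swap 1 3)

/-- A transposition acts on partitions as an involution, fixing exactly those with `{i, j}` as a
block. This is a finite check, used to cancel terms in `pfaffianForm`. -/
theorem sortDoubletons_swap_mul : ∀ σ ∈ doubletonPartitions, ∀ i j : Fin 6, i ≠ j →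
    sortDoubletons (Equiv.swap i j * σ) ∈ doubletonPartitions ∧
    sortDoubletons (Equiv.swap i j * sortDoubletons (Equiv.swap i j * σ)) = σ ∧
    (sortDoubletons (Equiv.swap i j * σ) = σ →
      s(σ 0, σ 1) = s(i, j) ∨ s(σ 2, σ 3) = s(i, j) ∨ s(σ 4, σ 5) = s(i, j)) := by
  unfold doubletonPartitions
  simp only [Finset.mem_filter, Finset.mem_univ, true_and]
  decide +kernel

section PfaffianForm

variable {M : Type*} [AddCommGroup M] [Module (ZMod 2) M]

/-- One term of the polarized Pfaffian of two forms. -/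
def pairingTerm (b₁ b₂ : LinearMap.BilinForm (ZMod 2) M) (h : Fin 6 → M)
    (σ : Equiv.Perm (Fin 6)) : ZMod 2 :=
  b₁ (h (σ 0)) (h (σ 1)) * b₁ (h (σ 2)) (h (σ 3)) * b₂ (h (σ 4)) (h (σ 5))

theorem LinearMap.BilinForm.IsAlt.comm_of_zmod_two {b : LinearMap.BilinForm (ZMod 2) M} (hb : b.IsAlt)
    (x y : M) : b x y = b y x := by
  rw [← hb.neg_eq, ZModModule.neg_eq_self]

theorem pairingTerm_sortDoubletons {b₁ b₂ : LinearMap.BilinForm (ZMod 2) M} (h₁ : b₁.IsAlt)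
    (h₂ : b₂.IsAlt) (h : Fin 6 → M) (τ : Equiv.Perm (Fin 6)) :
    pairingTerm b₁ b₂ h (sortDoubletons τ) = pairingTerm b₁ b₂ h τ := by
  have e1 : ∀ τ : Equiv.Perm (Fin 6),
      pairingTerm b₁ b₂ h (τ * Equiv.swap 0 1) = pairingTerm b₁ b₂ h τ := fun τ => by
    have : ∀ k : Fin 6, Equiv.swap (0 : Fin 6) 1 k = ![1, 0, 2, 3, 4, 5] k := by decide
    simp [pairingTerm, Equiv.Perm.mul_apply, this, h₁.comm_of_zmod_two (h (τ 1)) (h (τ 0)),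
      -Equiv.swap_apply_left, -Equiv.swap_apply_right]
  have e2 : ∀ τ : Equiv.Perm (Fin 6),
      pairingTerm b₁ b₂ h (τ * Equiv.swap 2 3) = pairingTerm b₁ b₂ h τ := fun τ => by
    have : ∀ k : Fin 6, Equiv.swap (2 : Fin 6) 3 k = ![0, 1, 3, 2, 4, 5] k := by decide
    simp [pairingTerm, Equiv.Perm.mul_apply, this, h₁.comm_of_zmod_two (h (τ 3)) (h (τ 2)),
      -Equiv.swap_apply_left, -Equiv.swap_apply_right]
  have e3 : ∀ τ : Equiv.Perm (Fin 6),
      pairingTerm b₁ b₂ h (τ * Equiv.swap 4 5) = pairingTerm b₁ b₂ h τ := fun τ => by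
    have : ∀ k : Fin 6, Equiv.swap (4 : Fin 6) 5 k = ![0, 1, 2, 3, 5, 4] k := by decide
    simp [pairingTerm, Equiv.Perm.mul_apply, this, h₂.comm_of_zmod_two (h (τ 5)) (h (τ 4)),
      -Equiv.swap_apply_left, -Equiv.swap_apply_right]
  have e4 : ∀ τ : Equiv.Perm (Fin 6),
      pairingTerm b₁ b₂ h (τ * (Equiv.swap 0 2 * Equiv.swap 1 3)) = pairingTerm b₁ b₂ h τ :=
    fun τ => by
    have : ∀ k : Fin 6, (Equiv.swap (0 : Fin 6) 2 * Equiv.swap (1 : Fin 6) 3) k =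
      ![2, 3, 0, 1, 4, 5] k := by decide
    simp only [pairingTerm, Equiv.Perm.mul_apply τ, this]
    simp [mul_comm]
  unfold sortDoubletons
  simp only [apply_ite (pairingTerm b₁ b₂ h), e1, e2, e3, e4, ite_self]

/-- The polarized Pfaffian `∑ b₁(h_a, h_b) b₁(h_c, h_d) b₂(h_e, h_f)` of two alternating
forms over `𝔽₂` is an alternating form. -/
def pfaffianForm (b₁ b₂ : LinearMap.BilinForm (ZMod 2) M) (h₁ : b₁.IsAlt) (h₂ : b₂.IsAlt) :
    M [⋀^Fin 6]→ₗ[ZMod 2] ZMod 2 where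
  toFun h := ∑ σ ∈ doubletonPartitions, pairingTerm b₁ b₂ h σ
  map_update_add' := by
    intro inst h i x y
    obtain rfl : inst = instDecidableEqFin 6 := Subsingleton.elim _ _
    rw [← Finset.sum_add_distrib]
    refine Finset.sum_congr rfl fun σ _ => ?_
    obtain ⟨j, rfl⟩ := σ.surjective i
    fin_cases j <;> simp [pairingTerm, σ.injective.eq_iff] <;> ring
  map_update_smul' := by
    intro inst h i c x
    obtain rfl : inst = instDecidableEqFin 6 := Subsingleton.elim _ _
    rw [Finset.smul_sum]
    refine Finset.sum_congr rfl fun σ _ => ?_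
    obtain ⟨j, rfl⟩ := σ.surjective i
    fin_cases j <;> simp [pairingTerm, σ.injective.eq_iff] <;> ring
  map_eq_zero_of_eq' := by
    intro h i j hij hne
    have hswap : ∀ σ : Equiv.Perm (Fin 6), pairingTerm b₁ b₂ h (Equiv.swap i j * σ) =
        pairingTerm b₁ b₂ h σ := by
      have : ∀ k, h (Equiv.swap i j k) = h k := by
        intro k
        rw [Equiv.swap_apply_def]
        split_ifs with e1 e2 <;> simp_all
      intro σ
      simp only [pairingTerm, Equiv.Perm.mul_apply, this]
    -- Partitions moved by the swap cancel in pairs; a fixed one has the block `{i, j}`, whose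
    -- factor is `b(h i, h i) = 0`.
    refine Finset.sum_involution (fun σ _ => sortDoubletons (Equiv.swap i j * σ))
      (fun σ _ => ?_) (fun σ hσ hne0 hfix => hne0 ?_)
      (fun σ hσ => (sortDoubletons_swap_mul σ hσ i j hne).1)
      (fun σ hσ => (sortDoubletons_swap_mul σ hσ i j hne).2.1)
    · rw [pairingTerm_sortDoubletons h₁ h₂, hswap, ZModModule.add_self]
    · have hpair : ∀ a b : Fin 6, s(a, b) = s(i, j) → h a = h b := by
        intro a b hab
        rcases Sym2.eq_iff.1 hab with ⟨rfl, rfl⟩ | ⟨rfl, rfl⟩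
        · exact hij
        · exact hij.symm
      rcases (sortDoubletons_swap_mul σ hσ i j hne).2.2 hfix with e | e | e
      · simp [pairingTerm, hpair _ _ e, h₁ _]
      · simp [pairingTerm, hpair _ _ e, h₁ _]
      · simp [pairingTerm, hpair _ _ e, h₂ _]

end PfaffianForm

/-! ### The cocycle `ρ` on parallelepipeds. -/

theorem boxSum_three {n : ℕ} {Z : Type*} [AddCommGroup Z] (F : (Fin n → ZMod 2) → Z)
    (x a b d : Fin n → ZMod 2) :
    boxSum F x ![a, b, d] = boxSum F x ![b, d] + boxSum F (x + a) ![b, d] := by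
  rw [boxSum_split F x _ 0]
  have e : (fun j => (![a, b, d] : Fin 3 → Fin n → ZMod 2) ((0 : Fin 3).succAbove j)) =
      ![b, d] := by
    funext j; fin_cases j <;> rfl
  rw [e]
  rfl

section SecondDiff

variable {n : ℕ} {c : Vertex n → X2}

/-- The second derivative at `0` of a coordinate of a function on `𝔽₂^n`. -/
def secondDiff (c : Vertex n → X2) (r : Fin 2) (a b : Fin n → ZMod 2) : ZMod 2 :=
  c (Vertex.ofF2 (a + b)) r + c (Vertex.ofF2 a) r + c (Vertex.ofF2 b) r +
    c (Vertex.ofF2 0) r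

theorem secondDiff_comm (c : Vertex n → X2) (r : Fin 2) (a b : Fin n → ZMod 2) :
    secondDiff c r a b = secondDiff c r b a := by
  unfold secondDiff
  rw [add_comm a b, add_right_comm (c (Vertex.ofF2 (b + a)) r)]

theorem secondDiff_self (c : Vertex n → X2) (r : Fin 2) (a : Fin n → ZMod 2) :
    secondDiff c r a a = 0 := by
  unfold secondDiff
  rw [ZModModule.add_self a, add_assoc (c (Vertex.ofF2 0) r), ZModModule.add_self, add_zero,
    ZModModule.add_self]

/-- Third derivatives of a quadratic vanish, so second ones do not depend on the base point;
bilinearity follows from this. -/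
theorem secondDiff_translate (hc : c ∈ X2.cubeStructure.cubes n) (r : Fin 2)
    (x a b : Fin n → ZMod 2) :
    c (Vertex.ofF2 (x + a + b)) r + c (Vertex.ofF2 (x + a)) r + c (Vertex.ofF2 (x + b)) r +
      c (Vertex.ofF2 x) r = secondDiff c r a b := by
  have h := congrFun (mem_degreeCubes_iff_boxSum.1 hc 0 ![x, a, b]) r
  rw [boxSum_three, boxSum_two, boxSum_two] at h
  simp only [Pi.add_apply, Pi.zero_apply, zero_add] at h
  unfold secondDiff
  have h2 : (2 : ZMod 2) = 0 := rfl
  linear_combination h - (c (Vertex.ofF2 (a + b)) r + c (Vertex.ofF2 a) r + c (Vertex.ofF2 b) r +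
    c (Vertex.ofF2 0) r) * h2

theorem secondDiff_add_left (hc : c ∈ X2.cubeStructure.cubes n) (r : Fin 2)
    (a a' b : Fin n → ZMod 2) :
    secondDiff c r (a + a') b = secondDiff c r a b + secondDiff c r a' b := by
  have h := secondDiff_translate hc r a a' b
  rw [← h]
  unfold secondDiff
  have h2 : (2 : ZMod 2) = 0 := rfl
  linear_combination -(c (Vertex.ofF2 (a + b)) r + c (Vertex.ofF2 a) r) * h2

theorem secondDiff_smul_left (c : Vertex n → X2) (r : Fin 2) (z : ZMod 2)
    (a b : Fin n → ZMod 2) : secondDiff c r (z • a) b = z • secondDiff c r a b := by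
  have h : ∀ z : ZMod 2, z = 0 ∨ z = 1 := by decide
  rcases h z with rfl | rfl
  · unfold secondDiff
    rw [zero_smul, zero_smul, zero_add, add_assoc,
      ZModModule.add_self]
  · rw [one_smul, one_smul]

/-- The second derivative of a coordinate of a cube of `X₂`, as a bilinear form. -/
def secondForm (hc : c ∈ X2.cubeStructure.cubes n) (r : Fin 2) :
    LinearMap.BilinForm (ZMod 2) (Fin n → ZMod 2) :=
  LinearMap.mk₂ (ZMod 2) (secondDiff c r) (secondDiff_add_left hc r) (secondDiff_smul_left c r)
    (fun a b b' => by
      rw [secondDiff_comm, secondDiff_add_left hc, secondDiff_comm c r b, secondDiff_comm c r b'])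
    (fun z a b => by rw [secondDiff_comm, secondDiff_smul_left, secondDiff_comm])

theorem secondForm_isAlt (hc : c ∈ X2.cubeStructure.cubes n) (r : Fin 2) :
    (secondForm hc r).IsAlt := fun a => secondDiff_self c r a

/-- The alternating form giving the value of `ρ` on parallelepipeds. -/
def rhoForm (hc : c ∈ X2.cubeStructure.cubes n) :
    (Fin n → ZMod 2) [⋀^Fin 6]→ₗ[ZMod 2] ZMod 2 :=
  pfaffianForm (secondForm hc 0) (secondForm hc 1) (secondForm_isAlt hc 0) (secondForm_isAlt hc 1)

theorem coeff_boxMap (hc : c ∈ X2.cubeStructure.cubes n) (x : Fin n → ZMod 2)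
    (h : Fin 6 → Fin n → ZMod 2) (r : Fin 2) (i j : Fin 6) (hij : i ≠ j) :
    X2.coeff (fun ω => c (boxMap x h ω)) i j r = secondDiff c r (h i) (h j) := by
  have e1 : ∀ i, boxMap x h (fun l => decide (l = i)) = Vertex.ofF2 (x + h i) := fun i => by
    simp [boxMap, Vertex.coords, ite_smul]
  have e2 : boxMap x h (fun l => decide (l = i ∨ l = j)) = Vertex.ofF2 (x + h i + h j) := by
    have : ∀ l : Fin 6, (if l = i ∨ l = j then (1 : ZMod 2) else 0) =
        (if l = i then 1 else 0) + if l = j then 1 else 0 := by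
      intro l
      by_cases h1 : l = i
      · simp [h1, hij]
      · simp [h1]
    simp [boxMap, Vertex.coords, this, add_smul, ite_smul, Finset.sum_add_distrib, add_assoc]
  have e3 : boxMap x h (fun _ => false) = Vertex.ofF2 x := by
    simp [boxMap, Vertex.coords]
  rw [← secondDiff_translate hc r x, X2.coeff, e1, e1, e2, e3]
  simp [ZModModule.sub_eq_add]

theorem rho_boxMap (hc : c ∈ X2.cubeStructure.cubes n) (x : Fin n → ZMod 2)
    (h : Fin 6 → Fin n → ZMod 2) : rho (fun ω => c (boxMap x h ω)) = rhoForm hc h := by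
  change _ = ∑ σ ∈ doubletonPartitions, pairingTerm (secondForm hc 0) (secondForm hc 1) h σ
  unfold rho
  refine Finset.sum_congr rfl fun σ _ => ?_
  rw [coeff_boxMap hc x h _ _ _ (σ.injective.ne (by decide)),
    coeff_boxMap hc x h _ _ _ (σ.injective.ne (by decide)),
    coeff_boxMap hc x h _ _ _ (σ.injective.ne (by decide))]
  rfl

end SecondDiff

theorem mem_X51_cubes_iff {n : ℕ} {c : Vertex n → X51} :
    c ∈ X51.cubeStructure.cubes n ↔
      ∃ hQ : (fun ω => (c ω).1) ∈ X2.cubeStructure.cubes n,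
        ∀ x h, boxSum (fun y => (c (Vertex.ofF2 y)).2) x h = rhoForm hQ h := by
  have key : ∀ hQ : (fun ω => (c ω).1) ∈ X2.cubeStructure.cubes n, ∀ x h,
      (alternatingSum (fun ω => (c (boxMap x h ω)).2) = rho (fun ω => (c (boxMap x h ω)).1)) ↔
        boxSum (fun y => (c (Vertex.ofF2 y)).2) x h = rhoForm hQ h := fun hQ x h => by
    rw [← rho_boxMap hQ x h, ← alternatingSum_boxMap (fun ω => (c ω).2)]
  exact ⟨fun ⟨hQ, hS⟩ => ⟨hQ, fun x h => (key hQ x h).1 (hS x h)⟩,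
    fun ⟨hQ, hS⟩ => ⟨hQ, fun x h => (key hQ x h).2 (hS x h)⟩⟩

/-! ### Invariance of cubes under affine maps over `𝔽₂`. -/

section Affine

variable {m n : ℕ}

theorem boxMap_affine {φ : Vertex m → Vertex n}
    {A : (Fin m → ZMod 2) →+ (Fin n → ZMod 2)} {v : Fin n → ZMod 2}
    (hφ : ∀ x, φ (Vertex.ofF2 x) = Vertex.ofF2 (v + A x)) {k : ℕ} (x : Fin m → ZMod 2)
    (h : Fin k → Fin m → ZMod 2) (ω : Vertex k) :
    φ (boxMap x h ω) = boxMap (v + A x) (fun i => A (h i)) ω := by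
  have hA : ∀ (z : ZMod 2) a, A (z • a) = z • A a := fun z a => ZMod.map_smul A z a
  rw [boxMap, hφ, boxMap]
  simp [map_add, map_sum, hA, add_assoc]

theorem degreeCubes_comp_affine {Z : Type*} [AddCommGroup Z] [Module (ZMod 2) Z] {d : ℕ}
    {φ : Vertex m → Vertex n}
    {A : (Fin m → ZMod 2) →+ (Fin n → ZMod 2)} {v : Fin n → ZMod 2}
    (hφ : ∀ x, φ (Vertex.ofF2 x) = Vertex.ofF2 (v + A x)) {c : Vertex n → Z}
    (hc : c ∈ (degreeCubes d Z).cubes n) : c ∘ φ ∈ (degreeCubes d Z).cubes m := by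
  rw [mem_degreeCubes_iff_boxSum] at hc ⊢
  intro x h
  rw [← hc (v + A x) fun i => A (h i)]
  exact Finset.sum_congr rfl fun ω _ => congrArg c (boxMap_affine hφ x h ω)

theorem X51.comp_affine {φ : Vertex m → Vertex n}
    {A : (Fin m → ZMod 2) →+ (Fin n → ZMod 2)} {v : Fin n → ZMod 2}
    (hφ : ∀ x, φ (Vertex.ofF2 x) = Vertex.ofF2 (v + A x)) {c : Vertex n → X51}
    (hc : c ∈ X51.cubeStructure.cubes n) : c ∘ φ ∈ X51.cubeStructure.cubes m := by
  refine ⟨degreeCubes_comp_affine hφ hc.1, fun x h => ?_⟩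
  simp only [Function.comp, boxMap_affine hφ]
  exact hc.2 _ _

theorem Vertex.coords_ofF2 (x : Fin n → ZMod 2) :
    Vertex.coords (ZMod 2) (Vertex.ofF2 x) = x := by
  have h : ∀ z : ZMod 2, (if decide (z = 1) = true then (1 : ZMod 2) else 0) = z := by decide
  exact funext fun i => h (x i)

theorem Vertex.ofF2_coords (ω : Vertex n) :
    Vertex.ofF2 (Vertex.coords (ZMod 2) ω) = ω := by
  funext i; cases hi : ω i <;> simp [Vertex.ofF2, Vertex.coords, hi]

theorem IsCubeMorphism.exists_affine {φ : Vertex m → Vertex n} (hφ : IsCubeMorphism φ) :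
    ∃ (A : (Fin m → ZMod 2) →+ (Fin n → ZMod 2)) (v : Fin n → ZMod 2),
      ∀ x, φ (Vertex.ofF2 x) = Vertex.ofF2 (v + A x) := by
  obtain ⟨g, hg⟩ := hφ
  -- Integer values at `0` and at the unit vectors force integer coefficients, which can then be
  -- reduced mod 2.
  have h01 : ∀ ω l, ∃ a : ℤ, g (Vertex.coords ℝ ω) l = a := fun ω l => by
    rw [hg]
    exact ⟨if φ ω l = true then 1 else 0, by simp [Vertex.coords]⟩
  have hlin : ∀ y, g y = g 0 + g.linear y := fun y => by
    have := g.map_vadd 0 y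
    simpa [add_comm] using this
  have c0 : Vertex.coords ℝ (fun _ : Fin m => false) = 0 := by
    funext i; simp [Vertex.coords]
  have c1 : ∀ i, Vertex.coords ℝ (fun l : Fin m => decide (l = i)) = Pi.single i 1 := fun i => by
    funext l; simp [Vertex.coords, Pi.single_apply]
  choose a ha using fun l => h01 (fun _ => false) l
  have hb : ∀ l i, ∃ b : ℤ, g.linear (Pi.single i 1) l = b := fun l i => by
    obtain ⟨b, hb⟩ := h01 (fun l => decide (l = i)) l
    have := congrFun (hlin (Pi.single i 1)) l
    rw [c1] at hb
    have ha' := ha l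
    rw [c0] at ha'
    rw [Pi.add_apply, hb, ha'] at this
    exact ⟨b - a l, by push_cast; linarith⟩
  choose b hb using hb
  have hval : ∀ ω l, (if φ ω l = true then (1 : ℤ) else 0) =
      a l + ∑ i, (if ω i = true then 1 else 0) * b l i := fun ω l => by
    have h1 := congrFun (hlin (Vertex.coords ℝ ω)) l
    have h2 : g.linear (Vertex.coords ℝ ω) =
        ∑ i, Vertex.coords ℝ ω i • g.linear (Pi.single i 1) := by
      rw [LinearMap.pi_apply_eq_sum_univ g.linear (Vertex.coords ℝ ω)]
      refine Finset.sum_congr rfl fun i _ => ?_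
      congr 2
      funext j
      simp [Pi.single_apply, eq_comm]
    have ha' := ha l
    rw [c0] at ha'
    rw [hg, Pi.add_apply, ha', h2, Finset.sum_apply] at h1
    simp only [Pi.smul_apply, hb, smul_eq_mul, Vertex.coords] at h1
    exact_mod_cast h1
  refine ⟨⟨⟨fun x l => ∑ i, x i * (b l i : ZMod 2), by funext l; simp⟩, fun x y => by
    funext l; simp [add_mul, Finset.sum_add_distrib]⟩, fun l => (a l : ZMod 2), fun x => ?_⟩
  rw [← Vertex.ofF2_coords (φ (Vertex.ofF2 x))]
  congr 1
  funext l
  have := congrArg (Int.cast : ℤ → ZMod 2) (hval (Vertex.ofF2 x) l)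
  push_cast at this
  simp only [Vertex.coords, this]
  refine congrArg ((a l : ZMod 2) + ·) (Finset.sum_congr rfl fun i _ => ?_)
  have hx := congrFun (Vertex.coords_ofF2 x) i
  simp only [Vertex.coords] at hx
  rw [hx]

theorem exists_affine_of_mem_degreeCubes_one {c : Vertex m → Fin n → ZMod 2}
    (hc : c ∈ (degreeCubes 1 (Fin n → ZMod 2)).cubes m) :
    ∃ (A : (Fin m → ZMod 2) →+ (Fin n → ZMod 2)) (v : Fin n → ZMod 2),
      ∀ x, c (Vertex.ofF2 x) = v + A x := by
  rw [mem_degreeCubes_iff_boxSum] at hc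
  set F : (Fin m → ZMod 2) → Fin n → ZMod 2 := fun y => c (Vertex.ofF2 y) with hF
  refine ⟨AddMonoidHom.mk' (fun x => F 0 + F x) fun x y => ?_, F 0, fun x => ?_⟩
  · have h := hc 0 ![x, y]
    rw [boxSum_two] at h
    simp only [zero_add] at h
    funext l
    have h := congrFun h l
    have h2 : (2 : ZMod 2) = 0 := rfl
    simp only [Pi.add_apply, Pi.zero_apply] at h ⊢
    linear_combination h - (F 0 l + F x l + F y l) * h2
  · change F x = F 0 + (F 0 + F x)
    rw [← add_assoc, ZModModule.add_self, zero_add]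

end Affine

/-! ### Corner completion, ergodicity and the 5-step property. -/

theorem Vertex.sum_ofF2 {n : ℕ} {Z : Type*} [AddCommMonoid Z] (F : Vertex n → Z) :
    ∑ v, F (Vertex.ofF2 v) = ∑ ω, F ω :=
  Function.Bijective.sum_comp (e := Vertex.ofF2 (n := n))
    (Function.bijective_iff_has_inverse.2
      ⟨Vertex.coords (ZMod 2), Vertex.coords_ofF2, Vertex.ofF2_coords⟩) F

theorem exists_sum_eq {n : ℕ} {Z : Type*} [AddCommGroup Z] (F : Vertex n → Z) (t : Z) :
    ∃ F' : Vertex n → Z, (∀ v, v ≠ Vertex.top n → F' v = F v) ∧ ∑ ω, F' ω = t := by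
  refine ⟨Function.update F (Vertex.top n) (t - ∑ ω ∈ Finset.univ.erase (Vertex.top n), F ω),
    fun v hv => Function.update_of_ne hv _ _, ?_⟩
  rw [← Finset.add_sum_erase _ _ (Finset.mem_univ (Vertex.top n)), Function.update_self,
    Finset.sum_congr rfl fun v hv => Function.update_of_ne (Finset.ne_of_mem_erase hv) _ F]
  exact sub_add_cancel _ _

theorem eq_of_sum_eq {n : ℕ} {Z : Type*} [AddCommGroup Z] {F F' : Vertex n → Z}
    (h : ∀ v, v ≠ Vertex.top n → F v = F' v) (hs : ∑ ω, F ω = ∑ ω, F' ω) : F = F' := by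
  rw [← Finset.add_sum_erase _ _ (Finset.mem_univ (Vertex.top n)),
    ← Finset.add_sum_erase _ F' (Finset.mem_univ (Vertex.top n)),
    Finset.sum_congr rfl fun v hv => h v (Finset.ne_of_mem_erase hv)] at hs
  funext v
  by_cases hv : v = Vertex.top n
  · rw [hv]; exact add_right_cancel hs
  · exact h v hv

theorem boxMap_face {n k : ℕ} {x : Fin (n + 1) → ZMod 2} {h : Fin k → Fin (n + 1) → ZMod 2}
    {j : Fin (n + 1)} (hx : x j = 0) (hh : ∀ l, h l j = 0) (ω : Vertex k) :
    boxMap x h ω = j.insertNth (α := fun _ => Bool) false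
      (boxMap (fun i => x (j.succAbove i)) (fun l i => h l (j.succAbove i)) ω) := by
  funext i
  refine j.succAboveCases ?_ (fun i => ?_) i
  · simp [boxMap, Vertex.ofF2, hx, hh]
  · simp [boxMap, Vertex.ofF2]

theorem boxMap_face_ne_top {n k : ℕ} {x : Fin (n + 1) → ZMod 2}
    {h : Fin k → Fin (n + 1) → ZMod 2} {j : Fin (n + 1)} (hx : x j = 0) (hh : ∀ l, h l j = 0)
    (ω : Vertex k) : boxMap x h ω ≠ Vertex.top (n + 1) := by
  intro e
  have := congrFun e j
  simp [boxMap_face hx hh, Vertex.top] at this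

theorem X51.completion (n : ℕ) (c' : Vertex (n + 1) → X51)
    (hc' : X51.cubeStructure.IsCorner n c') :
    ∃ c ∈ X51.cubeStructure.cubes (n + 1), ∀ v, v ≠ Vertex.top (n + 1) → c v = c' v := by
  obtain ⟨Q, hQ, hQs⟩ := exists_sum_eq (fun ω => (c' ω).1) 0
  have hQs' : ∑ v, Q (Vertex.ofF2 v) = 0 := by rw [Vertex.sum_ofF2, hQs]
  have hQc : Q ∈ X2.cubeStructure.cubes (n + 1) := by
    refine mem_degreeCubes_iff_boxSum.2 fun x h => ?_
    refine boxSum_eq_of_faces (fun y => Q (Vertex.ofF2 y)) 0 (fun j x h hx hh => ?_)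
      (fun _ => hQs') (fun _ => hQs') x h
    have := mem_degreeCubes_iff_boxSum.1 (hc' j).1 (fun i => x (j.succAbove i))
      (fun l i => h l (j.succAbove i))
    refine Eq.trans (Finset.sum_congr rfl fun ω _ => ?_) this
    change Q (boxMap x h ω) = _
    rw [hQ _ (boxMap_face_ne_top hx hh ω), boxMap_face hx hh]
    rfl
  -- The total of `S` must be the value of `ρ` in dimension 6 and `0` above it; below 6 it is
  -- unconstrained and the value `0` is arbitrary.
  obtain ⟨S, hS, hSs⟩ := exists_sum_eq (fun ω => (c' ω).2)
    (if e : n + 1 = 6 then rhoForm hQc (basisDirs (Fin.cast e.symm)) else 0)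
  rw [← Vertex.sum_ofF2] at hSs
  have hc : (fun ω => ((Q ω, S ω) : X51)) ∈ X51.cubeStructure.cubes (n + 1) := by
    refine mem_X51_cubes_iff.2 ⟨hQc, boxSum_eq_of_faces _ _ (fun j x h hx hh => ?_)
      (fun e => by rw [hSs, dif_pos e]) (fun hlt => by rw [hSs, dif_neg (by omega)])⟩
    have := (hc' j).2 (fun i => x (j.succAbove i)) (fun l i => h l (j.succAbove i))
    simp only [← boxMap_face hx hh] at this
    rw [← rho_boxMap hQc x h, ← alternatingSum_boxMap]
    simp only [hQ _ (boxMap_face_ne_top hx hh _), hS _ (boxMap_face_ne_top hx hh _)]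
    exact this
  exact ⟨_, hc, fun v hv => Prod.ext (hQ v hv) (hS v hv)⟩

/-- The conditions involve at least three distinct basis directions, so they are vacuous here. -/
theorem X51.mem_cubes_of_le {n : ℕ} (hn : n ≤ 2) (c : Vertex n → X51) :
    c ∈ X51.cubeStructure.cubes n := by
  have hI : ∀ {k : ℕ}, 2 < k → ∀ I : Fin k → Fin n, ¬ Function.Injective I := by
    intro k hk I hI
    have := Fintype.card_le_of_injective I hI
    simp only [Fintype.card_fin] at this
    omega
  have hQ : (fun ω => (c ω).1) ∈ X2.cubeStructure.cubes n :=
    mem_degreeCubes_iff_boxSum.2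
      (boxSum_eq_of_basis _ 0 fun x I h => absurd h (hI (by norm_num) I))
  exact mem_X51_cubes_iff.2
    ⟨hQ, boxSum_eq_of_basis _ _ fun x I h => absurd h (hI (by norm_num) I)⟩

theorem X51.isNilspace : X51.cubeStructure.IsNilspace where
  composition m n φ hφ c hc := by
    obtain ⟨A, v, h⟩ := hφ.exists_affine
    exact X51.comp_affine h hc
  zero_ergodic := Set.eq_univ_of_forall fun c => X51.mem_cubes_of_le (by norm_num) c
  completion := X51.completion

theorem X51.isErgodic : X51.cubeStructure.IsErgodic :=
  Set.eq_univ_of_forall fun c => X51.mem_cubes_of_le (by norm_num) c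

theorem sum_eq_zero_of_mem_degreeCubes {n d : ℕ} {Z : Type*} [AddCommGroup Z]
    [Module (ZMod 2) Z] (hd : d < n) {c : Vertex n → Z} (hc : c ∈ (degreeCubes d Z).cubes n) :
    ∑ ω, c ω = 0 := by
  obtain ⟨h, hh, hc⟩ := mem_degreeCubes_iff.1 hc
  rw [← alternatingSum_eq_sum, show c = cubeSum h from funext hc, alternatingSum_cubeSum]
  exact hh _ (by simpa [Vertex.weight, Vertex.top] using hd)

/-- On a 6-cube the total of `Q` is `0` and that of `S` is `ρ(Q)`, so both top values are determined
by the others. -/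
theorem X51.isStep : X51.cubeStructure.IsStep 5 := by
  intro c' _ c₁ h₁ c₂ h₂ e₁ e₂
  have e : ∀ v, v ≠ Vertex.top 6 → c₁ v = c₂ v := fun v hv => by rw [e₁ v hv, e₂ v hv]
  have hQ : (fun ω => (c₁ ω).1) = fun ω => (c₂ ω).1 :=
    eq_of_sum_eq (fun v hv => congrArg Prod.fst (e v hv)) (by
      rw [sum_eq_zero_of_mem_degreeCubes (by norm_num) h₁.1,
        sum_eq_zero_of_mem_degreeCubes (by norm_num) h₂.1])
  have hsum : ∀ c ∈ X51.cubeStructure.cubes 6, ∑ ω, (c ω).2 =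
      rho (fun ω => (fun ω => (c ω).1) (boxMap 0 (basisDirs id) ω)) := fun c hc => by
    obtain ⟨hQ, hS⟩ := mem_X51_cubes_iff.1 hc
    rw [rho_boxMap hQ, ← hS 0, boxSum_basis_univ _ _ _ Function.injective_id,
      Vertex.sum_ofF2 fun ω => (c ω).2]
  have hS : (fun ω => (c₁ ω).2) = fun ω => (c₂ ω).2 :=
    eq_of_sum_eq (fun v hv => congrArg Prod.snd (e v hv)) (by
      rw [hsum c₁ h₁, hsum c₂ h₂, hQ])
  exact funext fun ω => Prod.ext (congrFun hQ ω) (congrFun hS ω)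

/-! ### 2-homogeneity. -/

theorem coords_mem_degreeCubes (n : ℕ) :
    Vertex.coords ℤ ∈ (degreeCubes 1 (Fin n → ℤ)).cubes n := by
  refine mem_degreeCubes_iff.2
    ⟨fun α j => if α = fun i => decide (i = j) then 1 else 0, fun α hα => ?_, fun ω => ?_⟩
  · funext j
    refine if_neg ?_
    rintro rfl
    simp [Vertex.weight, Finset.filter_eq'] at hα
  · funext j
    rw [cubeSum, Finset.sum_apply, Finset.sum_ite_eq']
    simp [Vertex.coords]

theorem X51.isHomogeneous : X51.cubeStructure.IsHomogeneous 2 := by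
  intro n f hf m c hc
  obtain ⟨A, v, hA⟩ := exists_affine_of_mem_degreeCubes_one hc
  have hφ : ∀ x, (fun ω => Vertex.ofF2 (c ω)) (Vertex.ofF2 x) = Vertex.ofF2 (v + A x) :=
    fun x => congrArg Vertex.ofF2 (hA x)
  have h2 : ∀ z : ZMod 2, (if decide (z = 1) = true then (1 : ℤ) else 0) = (z.val : ℤ) := by
    decide
  -- The restriction of `f` to `{0,1}^n` is itself an `n`-cube, and the periodic extension along `c`
  -- is its composition with an `𝔽₂`-affine map.
  convert X51.comp_affine (φ := fun ω => Vertex.ofF2 (c ω)) hφ (hf n _ (coords_mem_degreeCubes n)) using 1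
  funext ω
  refine congrArg f (funext fun i => ?_)
  exact (h2 (c ω i)).symm

/-! ### Morphisms shift all vertical fibres equally. -/

theorem X51.add_vertical_mem_cubes {n : ℕ} {c : Vertex n → X51}
    (hc : c ∈ X51.cubeStructure.cubes n) {δ : Vertex n → ZMod 2}
    (hδ : ∀ x (h : Fin 6 → Fin n → ZMod 2), boxSum (fun y => δ (Vertex.ofF2 y)) x h = 0) :
    (fun ω => (((c ω).1, (c ω).2 + δ ω) : X51)) ∈ X51.cubeStructure.cubes n := by
  obtain ⟨hQ, hS⟩ := mem_X51_cubes_iff.1 hc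
  refine mem_X51_cubes_iff.2 ⟨hQ, fun x h => ?_⟩
  rw [← hS x h, ← add_zero (boxSum (fun y => (c (Vertex.ofF2 y)).2) x h), ← hδ x h]
  exact Finset.sum_add_distrib

/-- The indicator of the edge `{(1,1,1,1,1,0), (1,1,1,1,1,1)}`. -/
def topEdge (ω : Vertex 6) : ZMod 2 := if ∀ i, i ≠ 5 → ω i = true then 1 else 0

/-- The indicator is invariant along the last basis vector, which occurs among any six distinct
ones. -/
theorem boxSum_topEdge (x : Fin 6 → ZMod 2) (h : Fin 6 → Fin 6 → ZMod 2) :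
    boxSum (fun y => topEdge (Vertex.ofF2 y)) x h = 0 := by
  refine boxSum_eq_of_basis _ 0 (fun x I hI => ?_) x h
  obtain ⟨l, hl⟩ := Finite.surjective_of_injective hI 5
  refine boxSum_eq_zero_of_invariant _ _ _ l fun v => ?_
  have : ∀ i, i ≠ 5 →
      Vertex.ofF2 (v + basisDirs I l) i = Vertex.ofF2 v i := fun i hi => by
    simp [Vertex.ofF2, basisDirs, hl, hi]
  unfold topEdge
  exact if_congr (forall₂_congr fun i hi => by rw [this i hi]) rfl rfl

section Morphism

variable {G : Type*} [AddCommGroup G] {F : AbFiltration G} {f : X51 → G}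

/-- A morphism to a `5`-step filtered group shifts by a constant along the fibres over `X₂`. -/
theorem X51.vertical_difference_eq (hF : F.DegreeLE 5)
    (hf : X51.cubeStructure.IsMorphism F.cubeStructure f) (p q : X51) :
    f (p.1, p.2 + 1) - f p = f (q.1, q.2 + 1) - f q := by
  -- This degenerate cube has `p` and `q` at the two ends of the edge supporting `topEdge`; adding
  -- `topEdge` shifts just these two values.
  have hc : (fun ω : Vertex 6 => if ω 5 = true then q else p) ∈ X51.cubeStructure.cubes 6 :=
    X51.comp_affine (φ := fun ω : Vertex 6 => fun _ : Fin 1 => ω 5) (v := 0)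
      (A := ⟨⟨fun x _ => x 5, rfl⟩, fun _ _ => rfl⟩) (fun x => by
        funext i; simp [Vertex.ofF2])
      (X51.mem_cubes_of_le (n := 1) (by norm_num) fun ω => if ω 0 = true then q else p)
  have h1 := alternatingSum_eq_zero_of_mem_cubes hF (hf 6 _ hc)
  have h2 := alternatingSum_eq_zero_of_mem_cubes hF
    (hf 6 _ (X51.add_vertical_mem_cubes hc boxSum_topEdge))
  rw [← sub_eq_zero, ← neg_eq_zero]
  have h3 := congrArg₂ (· - ·) h2 h1
  simp only [alternatingSum, ← Finset.sum_sub_distrib, ← smul_sub, Function.comp,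
    sub_zero] at h3
  -- The two surviving vertices carry opposite signs, which equates the shifts at `p` and `q`.
  rw [Fintype.sum_eq_add (fun i => decide (i ≠ 5)) (Vertex.top 6)] at h3
  · have w1 : Vertex.weight (fun i : Fin 6 => decide (i ≠ 5)) = 5 := by decide
    have w2 : Vertex.weight (Vertex.top 6) = 6 := by decide
    have t1 : topEdge (fun i : Fin 6 => decide (i ≠ 5)) = 1 := by decide
    have t2 : topEdge (Vertex.top 6) = 1 := by decide
    rw [w1, w2, t1, t2] at h3
    simp only [Vertex.top, if_true, ne_eq, not_true_eq_false, decide_false, Bool.false_eq_true,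
      if_false] at h3
    rw [← h3]
    norm_num
    abel
  · intro e
    simpa [Vertex.top] using congrFun e 5
  · rintro ω ⟨hv, hw⟩
    have : topEdge ω = 0 := by
      refine if_neg fun h => ?_
      cases h5 : ω 5
      · refine hv (funext fun i => ?_)
        by_cases hi : i = 5
        · simp [hi, h5]
        · simp [hi, h i hi]
      · refine hw (funext fun i => ?_)
        by_cases hi : i = 5
        · rw [hi, h5]; rfl
        · rw [h i hi]; rfl
    rw [this, add_zero, sub_self, smul_zero]

end Morphism

/-! ### The obstructing 6-cube. -/

/-- The monomial coefficients of the `6`-cube `ω ↦ (ω₁ω₂ + ω₅ω₆, ω₃ω₄ + ω₅ω₆)` of `X₂`. -/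
def pencilCoeff (α : Vertex 6) : X2 :=
  ![if α = ![true, true, false, false, false, false] ∨
        α = ![false, false, false, false, true, true] then 1 else 0,
    if α = ![false, false, true, true, false, false] ∨
        α = ![false, false, false, false, true, true] then 1 else 0]

/-- The `6`-cube `ω ↦ (ω₁ω₂ + ω₅ω₆, ω₃ω₄ + ω₅ω₆)` of `X₂`. -/
def pencilCube : Vertex 6 → X2 := fun ω =>
  let b : Fin 6 → ZMod 2 := Vertex.coords (ZMod 2) ω
  ![b 0 * b 1 + b 4 * b 5, b 2 * b 3 + b 4 * b 5]

theorem pencilCube_mem_cubes : pencilCube ∈ X2.cubeStructure.cubes 6 :=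
  mem_degreeCubes_iff.2 ⟨pencilCoeff, by decide +kernel, by unfold cubeSum; decide +kernel⟩

/-- Only the partition with first-coordinate blocks `{1,2}, {5,6}` and second-coordinate block
`{3,4}` contributes. -/
theorem rho_pencilCube : rho pencilCube = 1 := by
  unfold rho doubletonPartitions
  decide +kernel

/-- Each `𝔽₂`-combination of the two coordinates omits a pair of variables, so its character sum
against `(-1)^|ω|` vanishes; by Fourier inversion the signed count of every fibre is zero. -/
theorem sum_sign_pencilCube : ∀ x : X2,
    ∑ ω ∈ Finset.univ.filter (fun ω => pencilCube ω = x), (-1 : ℤ) ^ (6 - ω.weight) = 0 := by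
  decide +kernel

/-- Every function on `X₂` has vanishing alternating sum along `pencilCube`. -/
theorem alternatingSum_comp_pencilCube {G : Type*} [AddCommGroup G] (g : X2 → G) :
    alternatingSum (fun ω => g (pencilCube ω)) = 0 := by
  unfold alternatingSum
  rw [← Finset.sum_fiberwise _ pencilCube]
  refine Finset.sum_eq_zero fun x _ => ?_
  rw [← zero_smul ℤ (g x), ← sum_sign_pencilCube x, Finset.sum_smul]
  refine Finset.sum_congr rfl fun ω hω => ?_
  simp only [(Finset.mem_filter.1 hω).2]

theorem boxMap_basisDirs_id {n : ℕ} (ω : Vertex n) : boxMap 0 (basisDirs id) ω = ω := by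
  conv_rhs => rw [← Vertex.ofF2_coords ω]
  unfold boxMap
  congr 1
  funext i
  simp [basisDirs, Pi.single_apply]

/-- Six distinct basis directions sweep out all of `𝔽₂^6`, so the only condition is that the total
of the second coordinate be `ρ(pencilCube) = 1`. -/
theorem pencilCube_lift_mem_cubes :
    (fun ω => ((pencilCube ω, if ω = Vertex.top 6 then 1 else 0) : X51)) ∈
      X51.cubeStructure.cubes 6 := by
  refine mem_X51_cubes_iff.2 ⟨pencilCube_mem_cubes, boxSum_eq_of_basis _ _ fun x I hI => ?_⟩
  rw [boxSum_basis_univ _ _ _ hI, AlternatingMap.basisDirs_perm _ I hI,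
    ← rho_boxMap pencilCube_mem_cubes 0, Vertex.sum_ofF2 fun ω => if ω = Vertex.top 6 then _ else _]
  simp only [boxMap_basisDirs_id]
  rw [Finset.sum_ite_eq' Finset.univ (Vertex.top 6), if_pos (Finset.mem_univ _)]
  exact rho_pencilCube.symm

theorem X51.not_injective_of_isMorphism {G : Type*} [AddCommGroup G] {F : AbFiltration G}
    (hF : F.DegreeLE 5) {f : X51 → G} (hf : X51.cubeStructure.IsMorphism F.cubeStructure f) :
    ¬ Function.Injective f := by
  intro hinj
  have hd : ∀ x : X2, f (x, 1) = f (x, 0) + (f (0, 1) - f (0, 0)) := fun x => by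
    have := X51.vertical_difference_eq hF hf (x, 0) (0, 0)
    simp only [zero_add] at this
    rw [← this, add_sub_cancel]
  have h := alternatingSum_eq_zero_of_mem_cubes hF (hf 6 _ pencilCube_lift_mem_cubes)
  have h' := alternatingSum_comp_pencilCube fun x => f (x, 0)
  -- The lift differs from the zero section over `pencilCube` only at the top vertex, which has sign
  -- `+1`.
  have key : alternatingSum (f ∘ fun ω => ((pencilCube ω, if ω = Vertex.top 6 then 1 else 0) : X51))
      - alternatingSum (fun ω => f (pencilCube ω, 0)) = f (0, 1) - f (0, 0) := by
    unfold alternatingSum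
    rw [← Finset.sum_sub_distrib, Fintype.sum_eq_single (Vertex.top 6)]
    · have : Vertex.weight (Vertex.top 6) = 6 := by decide
      simp [this, hd (pencilCube (Vertex.top 6))]
    · intro ω hω
      simp [hω]
  rw [h, h', sub_zero] at key
  have := hinj (sub_eq_zero.1 key.symm)
  simp at this

theorem mainTheorem5 :
    (Finite X51 ∧ X51.cubeStructure.IsNilspace ∧ X51.cubeStructure.IsErgodic ∧
      X51.cubeStructure.IsStep 5 ∧ X51.cubeStructure.IsHomogeneous 2) ∧
    ∀ (G : Type*) [AddCommGroup G] [TopologicalSpace G] [IsTopologicalAddGroup G]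
      [CompactSpace G] [T2Space G] (F : AbFiltration G), F.DegreeLE 5 →
      ¬ ∃ f : X51 → G, Function.Injective f ∧
        X51.cubeStructure.IsMorphism F.cubeStructure f :=
  ⟨⟨inferInstance, X51.isNilspace, X51.isErgodic, X51.isStep, X51.isHomogeneous⟩,
    fun _ _ _ _ _ _ _ hF ⟨_, hinj, hf⟩ => X51.not_injective_of_isMorphism hF hf hinj⟩
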